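/- A \emph{time bound} is a function $f:\mathbb N\to\mathbb N$ with $n\le f(n)\le f(n+1)$ for all $n\in\mathbb N$. $\mathrm{DT}(f)$ denotes the class of all languages over finite alphabets that are accepted by a deterministic Turing machine (DTM) with a read-only input tape and some finite number $b\in\mathbb N$ of additional work tapes which halts on every input word $w$ after at most $t(|w|)$ steps, for some $t\in O(f)$. A time bound $g$ is \emph{time-constructible} if there is such a DTM that, for every input word $w$, writes the word $1^{g(|w|)}$ on one of its work tapes and halts after at most $t(|w|)$ steps, for some $t\in O(g)$. For a time bound $f$, the \emph{gap property} $G(f)$ means that there is a time-constructible time bound $f_2$ with $f\in o(f_2)$ and $\mathrm{DT}(f)=\mathrm{DT}(f_2)$. \textbf{Lemma 5.} Let $f$ and $g$ be time bounds. If $G(f)$ holds and $g$ is time-constructible, then $G(f\circ g)$ holds. -/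

import Mathlib

open Filter Asymptotics

/-- A time bound: a function `f : ℕ → ℕ` with `n ≤ f n ≤ f (n + 1)` for all `n`. -/
def IsTimeBound (f : ℕ → ℕ) : Prop :=
  ∀ n, n ≤ f n ∧ f n ≤ f (n + 1)

/-- A head movement. -/
inductive HeadMove : Type
  | left
  | stay
  | right

/-- The effect of a movement on a head position.  Cells are numbered from `0`; a head that is told
to move left on cell `0` stays there. -/
def HeadMove.apply : HeadMove → ℕ → ℕ
  | .left, p => p - 1
  | .stay, p => p
  | .right, p => p + 1

/-- What may be read on the input tape: one of the two end markers or an input letter. -/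
inductive InputSymbol (α : Type) : Type
  | leftEnd
  | letter (a : α)
  | rightEnd

/-- The cell `p` of the input tape holding the word `w` between end markers: the left end marker in
cell `0`, the letters of `w` in cells `1, …, |w|`, the right end marker in cell `|w| + 1`. -/
def inputSymbolAt {α : Type} (w : List α) (p : ℕ) : InputSymbol α :=
  if p = 0 then .leftEnd
  else match w[p - 1]? with
    | some a => .letter a
    | none => .rightEnd

/-- A deterministic Turing machine with input alphabet `α`, a two-way read-only input tape and `b`
work tapes, with finitely many states and work tape symbols.  Depending on the state, the scanned
input symbol and the scanned work tape symbols, the machine either halts (`none`), or passes to a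
new state, moves the input head, and on every work tape writes a symbol and moves the head. -/
structure DTM (α : Type) (b : ℕ) where
  /-- the states -/
  Q : Type
  /-- the work tape symbols -/
  Γ : Type
  finite_Q : Finite Q
  finite_Γ : Finite Γ
  /-- the blank symbol -/
  blank : Γ
  /-- the initial state -/
  start : Q
  /-- the accepting states -/
  accepting : Set Q
  /-- the transition function -/
  δ : Q → InputSymbol α → (Fin b → Γ) → Option (Q × HeadMove × (Fin b → Γ × HeadMove))

namespace DTM

variable {α : Type} {b : ℕ}

/-- A configuration (without the input word, which never changes).  The work tapes are infinite to
the right. -/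
structure Cfg (M : DTM α b) where
  state : M.Q
  inputHead : ℕ
  head : Fin b → ℕ
  tape : Fin b → ℕ → M.Γ

/-- The initial configuration: all heads on cell `0`, all work tapes blank. -/
def init (M : DTM α b) : M.Cfg where
  state := M.start
  inputHead := 0
  head := fun _ => 0
  tape := fun _ _ => M.blank

/-- What the machine does next in the configuration `c`, on the input word `w`. -/
def action (M : DTM α b) (w : List α) (c : M.Cfg) :
    Option (M.Q × HeadMove × (Fin b → M.Γ × HeadMove)) :=
  M.δ c.state (inputSymbolAt w c.inputHead) (fun i => c.tape i (c.head i))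

/-- A configuration in which the machine halts. -/
def Halted (M : DTM α b) (w : List α) (c : M.Cfg) : Prop :=
  M.action w c = none

/-- One step of the machine on the input word `w`; a halting configuration is kept as it is.  The
input head never leaves the cells `0, …, |w| + 1`. -/
def step (M : DTM α b) (w : List α) (c : M.Cfg) : M.Cfg :=
  match M.action w c with
  | none => c
  | some (q, m, a) =>
    { state := q
      inputHead := min (m.apply c.inputHead) (w.length + 1)
      head := fun i => (a i).2.apply (c.head i)
      tape := fun i => Function.update (c.tape i) (c.head i) (a i).1 }

/-- The configuration after `t` steps on the input word `w`, or the halting configuration if the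
machine has halted before.  Hence the machine halts on `w` after at most `t` steps if and only if
`M.Halted w (M.run w t)`. -/
def run (M : DTM α b) (w : List α) (t : ℕ) : M.Cfg :=
  (M.step w)^[t] M.init

end DTM

/-- `t ∈ O(f)`. -/
def InBigO (t f : ℕ → ℕ) : Prop :=
  (fun n => (t n : ℝ)) =O[atTop] (fun n => (f n : ℝ))

/-- `f ∈ o(f₂)`. -/
def InLittleO (f f₂ : ℕ → ℕ) : Prop :=
  (fun n => (f n : ℝ)) =o[atTop] (fun n => (f₂ n : ℝ))

/-- The languages over the alphabet `α` in the class `DT_b(f)`: those accepted by a deterministic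
Turing machine with `b` work tapes that halts on every input word `w` after at most `t |w|` steps,
where `t ∈ O(f)`. -/
def DTTapes (α : Type) (b : ℕ) (f : ℕ → ℕ) : Set (Language α) :=
  {L | ∃ (M : DTM α b) (t : ℕ → ℕ), InBigO t f ∧
    ∀ w : List α, M.Halted w (M.run w (t w.length)) ∧
      ((M.run w (t w.length)).state ∈ M.accepting ↔ w ∈ L)}

/-- The languages over the alphabet `α` in the class `DT(f)`, with any number of work tapes. -/
def DT (α : Type) (f : ℕ → ℕ) : Set (Language α) :=
  ⋃ b : ℕ, DTTapes α b f

/-- Time-constructibility of `g` by machines with `b` work tapes: for every finite input alphabet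
there is such a machine that, on any input word `w`, writes the word `1^(g |w|)` on one of its work
tapes (which is blank behind this word) and halts after at most `t |w|` steps, where `t ∈ O(g)`. -/
def TimeConstructibleBy (b : ℕ) (g : ℕ → ℕ) : Prop :=
  ∀ (α : Type) [Finite α], ∃ (M : DTM α b) (one : M.Γ) (j : Fin b) (t : ℕ → ℕ),
    one ≠ M.blank ∧ InBigO t g ∧
    ∀ w : List α, M.Halted w (M.run w (t w.length)) ∧
      ∀ p : ℕ, (M.run w (t w.length)).tape j p = if p < g w.length then one else M.blank

/-- Time-constructibility. -/
def TimeConstructible (g : ℕ → ℕ) : Prop :=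
  ∃ b : ℕ, TimeConstructibleBy b g

/-- The gap property `G(f)`: there is a time-constructible time bound `f₂` with `f ∈ o(f₂)` and
`DT(f) = DT(f₂)`, that is, the two classes contain the same languages over every finite
alphabet. -/
def GapProperty (f : ℕ → ℕ) : Prop :=
  ∃ f₂ : ℕ → ℕ, IsTimeBound f₂ ∧ TimeConstructible f₂ ∧ InLittleO f f₂ ∧
    ∀ (α : Type) [Finite α], DT α f = DT α f₂

theorem update_comp {A B : Type} (F : ℕ → A → B) (u : ℕ → A) (k : ℕ) (a : A) :
    Function.update (fun p => F p (u p)) k (F k a) = fun p => F p (Function.update u k a p) := by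
  funext p
  rcases eq_or_ne p k with rfl | h
  · simp
  · simp [h]

instance InputSymbol.finite {α : Type} [Finite α] : Finite (InputSymbol α) := by
  refine Finite.of_surjective
    (fun s : Option (Option α) => match s with
      | none => InputSymbol.leftEnd
      | some none => InputSymbol.rightEnd
      | some (some a) => InputSymbol.letter a) ?_
  rintro (_ | a | _)
  exacts [⟨none, rfl⟩, ⟨some (some a), rfl⟩, ⟨some none, rfl⟩]

section InputSymbolAt

variable {α : Type}

@[simp] theorem inputSymbolAt_zero (w : List α) : inputSymbolAt w 0 = .leftEnd := rfl

theorem inputSymbolAt_succ (w : List α) (p : ℕ) :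
    inputSymbolAt w (p + 1) = match w[p]? with
      | some a => .letter a
      | none => .rightEnd := by
  simp only [inputSymbolAt, Nat.add_eq_zero_iff, one_ne_zero, and_false, if_false,
    Nat.add_sub_cancel]

theorem inputSymbolAt_eq_leftEnd_iff {w : List α} {p : ℕ} :
    inputSymbolAt w p = .leftEnd ↔ p = 0 := by
  cases p with
  | zero => simp
  | succ p => rw [inputSymbolAt_succ]; cases w[p]? <;> simp

theorem inputSymbolAt_eq_rightEnd_iff {w : List α} {p : ℕ} :
    inputSymbolAt w p = .rightEnd ↔ w.length + 1 ≤ p := by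
  cases p with
  | zero => simp
  | succ p =>
    rw [inputSymbolAt_succ]
    cases h : w[p]? with
    | none => simpa using h
    | some a =>
      have := (List.getElem?_eq_some_iff.1 h).1
      simp only [reduceCtorEq, false_iff]
      omega

theorem inputSymbolAt_min (w : List α) (p : ℕ) :
    inputSymbolAt w (min p (w.length + 1)) = inputSymbolAt w p := by
  rcases le_total p (w.length + 1) with h | h
  · rw [min_eq_left h]
  · rw [min_eq_right h, inputSymbolAt_eq_rightEnd_iff.2 h, inputSymbolAt_eq_rightEnd_iff.2 le_rfl]

end InputSymbolAt

@[simp] theorem HeadMove.left_apply (p : ℕ) : HeadMove.left.apply p = p - 1 := rfl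

@[simp] theorem HeadMove.stay_apply (p : ℕ) : HeadMove.stay.apply p = p := rfl

@[simp] theorem HeadMove.right_apply (p : ℕ) : HeadMove.right.apply p = p + 1 := rfl

theorem HeadMove.apply_le (m : HeadMove) (p : ℕ) : m.apply p ≤ p + 1 := by
  cases m <;> simp only [HeadMove.apply] <;> omega

/-- The movement of a head on an input tape, with a movement past the right end marker dropped. -/
def HeadMove.clamp {α : Type} : HeadMove → InputSymbol α → HeadMove
  | .right, .rightEnd => .stay
  | m, _ => m

theorem HeadMove.clamp_apply {α : Type} (m : HeadMove) (w : List α) {p : ℕ}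
    (hp : p ≤ w.length + 1) :
    (m.clamp (inputSymbolAt w p)).apply p = min (m.apply p) (w.length + 1) := by
  have h := inputSymbolAt_eq_rightEnd_iff (w := w) (p := p)
  cases m
  · simp only [clamp, HeadMove.apply]; omega
  · simp only [clamp, HeadMove.apply]; omega
  · cases hs : inputSymbolAt w p <;>
      simp only [hs, reduceCtorEq, false_iff, true_iff, clamp, HeadMove.apply] at h ⊢ <;> omega

namespace DTM

variable {α : Type} {b : ℕ} (M : DTM α b) (w : List α)

theorem Cfg.ext_fields {M : DTM α b} {c c' : M.Cfg} (hs : c.state = c'.state)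
    (hi : c.inputHead = c'.inputHead) (hh : c.head = c'.head) (ht : c.tape = c'.tape) : c = c' := by
  cases c; cases c'; simp_all

@[simp] theorem run_zero : M.run w 0 = M.init := rfl

theorem run_succ (n : ℕ) : M.run w (n + 1) = M.step w (M.run w n) :=
  Function.iterate_succ_apply' _ _ _

variable {M w}

theorem step_of_action_eq_none {c : M.Cfg} (h : M.action w c = none) : M.step w c = c := by
  simp [step, h]

theorem step_of_action_eq_some {c : M.Cfg} {q : M.Q} {m : HeadMove}
    {a : Fin b → M.Γ × HeadMove} (h : M.action w c = some (q, m, a)) :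
    M.step w c =
      { state := q
        inputHead := min (m.apply c.inputHead) (w.length + 1)
        head := fun i => (a i).2.apply (c.head i)
        tape := fun i => Function.update (c.tape i) (c.head i) (a i).1 } := by
  simp [step, h]

theorem run_eq_of_halted {n t : ℕ} (hn : M.Halted w (M.run w n)) (h : n ≤ t) :
    M.run w t = M.run w n := by
  induction t, h using Nat.le_induction with
  | base => rfl
  | succ t _ ih => rw [run_succ, ih, step_of_action_eq_none hn]

theorem exists_first_halted {t : ℕ} (h : M.Halted w (M.run w t)) :
    ∃ n ≤ t, M.Halted w (M.run w n) ∧ M.run w t = M.run w n ∧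
      ∀ k < n, ¬ M.Halted w (M.run w k) := by
  classical
  have hex : ∃ n, M.Halted w (M.run w n) := ⟨t, h⟩
  exact ⟨Nat.find hex, Nat.find_min' hex h, Nat.find_spec hex,
    run_eq_of_halted (Nat.find_spec hex) (Nat.find_min' hex h), fun k hk => Nat.find_min hex hk⟩

theorem inputHead_step_le {c : M.Cfg} (h : c.inputHead ≤ w.length + 1) :
    (M.step w c).inputHead ≤ w.length + 1 := by
  rcases ha : M.action w c with _ | ⟨q, m, a⟩
  · rwa [step_of_action_eq_none ha]
  · rw [step_of_action_eq_some ha]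
    exact min_le_right _ _

theorem inputHead_run_le_length (n : ℕ) : (M.run w n).inputHead ≤ w.length + 1 := by
  induction n with
  | zero => simp [init]
  | succ n ih => rw [run_succ]; exact inputHead_step_le ih

theorem heads_run_le (n : ℕ) :
    (M.run w n).inputHead ≤ n ∧ ∀ i, (M.run w n).head i ≤ n := by
  induction n with
  | zero => simp [init]
  | succ n ih =>
    rw [run_succ]
    rcases ha : M.action w (M.run w n) with _ | ⟨q, m, a⟩
    · rw [step_of_action_eq_none ha]
      exact ⟨ih.1.trans n.le_succ, fun i => (ih.2 i).trans n.le_succ⟩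
    · rw [step_of_action_eq_some ha]
      exact ⟨(min_le_left _ _).trans ((m.apply_le _).trans (Nat.succ_le_succ ih.1)),
        fun i => ((a i).2.apply_le _).trans (Nat.succ_le_succ (ih.2 i))⟩

end DTM

/-- The stages of a machine that first generates a unary word, then uses it to lay out a virtual
input word on a work tape, and finally simulates another machine on this virtual input word. -/
inductive Stage (Q₁ Q₂ : Type) (K : ℕ) : Type
  | generate (q : Q₁)
  | rewind
  | copy
  | back
  | simulate (q : Q₂) (c : Fin (K + 1))
  | timeout

instance Stage.finite {Q₁ Q₂ : Type} {K : ℕ} [Finite Q₁] [Finite Q₂] :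
    Finite (Stage Q₁ Q₂ K) := by
  refine Finite.of_surjective
    (fun s : Q₁ ⊕ (Q₂ × Fin (K + 1)) ⊕ Fin 4 => match s with
      | .inl q => Stage.generate q
      | .inr (.inl (q, c)) => Stage.simulate q c
      | .inr (.inr 0) => Stage.rewind
      | .inr (.inr 1) => Stage.copy
      | .inr (.inr 2) => Stage.back
      | .inr (.inr 3) => Stage.timeout) ?_
  rintro (q | _ | _ | _ | ⟨q, c⟩ | _)
  exacts [⟨.inl q, rfl⟩, ⟨.inr (.inr 0), rfl⟩, ⟨.inr (.inr 1), rfl⟩, ⟨.inr (.inr 2), rfl⟩,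
    ⟨.inr (.inl (q, c)), rfl⟩, ⟨.inr (.inr 3), rfl⟩]

/-- The data of a pipeline: the machine `G` writes a unary word on its tape `j`; along this word,
the input symbols, translated by `h`, are copied to a virtual input tape, on which `N` is simulated.
If `clocked` is set, the simulation is stopped as soon as `K + 1` steps have been made for every
letter of the unary word, and `K` further steps. -/
structure Pipeline (α β : Type) (b₁ b₂ : ℕ) where
  G : DTM α b₁
  N : DTM β b₂
  j : Fin b₁
  h : InputSymbol α → InputSymbol β
  h_ne : ∀ s, h s ≠ .leftEnd
  K : ℕ
  clocked : Prop

namespace Pipeline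

variable {α β : Type} {b₁ b₂ : ℕ}

/-- The tapes of a pipeline: those of `G`, those of `N`, and the virtual input tape. -/
abbrev TapeIndex (b₁ b₂ : ℕ) : Type := Fin b₁ ⊕ Fin b₂ ⊕ Unit

/-- The number of tapes of a pipeline. -/
abbrev numTapes (b₁ b₂ : ℕ) : ℕ := Fintype.card (TapeIndex b₁ b₂)

/-- The numbering of the tapes. -/
noncomputable abbrev tapeEquiv (b₁ b₂ : ℕ) : TapeIndex b₁ b₂ ≃ Fin (numTapes b₁ b₂) :=
  Fintype.equivFin _

variable (P : Pipeline α β b₁ b₂)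

/-- The stages of the pipeline. -/
abbrev State : Type := Stage P.G.Q P.N.Q P.K

/-- The tape symbols: a symbol of `G` with a flag for the leftmost cell, a symbol of the virtual
input tape, and a symbol of `N`. -/
abbrev Symbol : Type := (P.G.Γ × Bool) × InputSymbol β × P.N.Γ

/-- What is done on the tapes of `G`, on the virtual input tape and on the tapes of `N`. -/
abbrev TapeActions : Type :=
  (Fin b₁ → P.G.Γ × HeadMove) × (InputSymbol β × HeadMove) × (Fin b₂ → P.N.Γ × HeadMove)

open Classical in
/-- The transition function after the first step, in terms of the scanned symbols and of whether
the head on tape `j` of `G` is on the leftmost cell. -/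
noncomputable def control (st : P.State) (s : InputSymbol α) (r₁ : Fin b₁ → P.G.Γ) (atStart : Bool)
    (v : InputSymbol β) (r₂ : Fin b₂ → P.N.Γ) : Option (P.State × HeadMove × P.TapeActions) :=
  match st with
  | .generate q =>
    match P.G.δ q s r₁ with
    | some (q', m, a) => some (.generate q', m, a, (v, .stay), fun i => (r₂ i, .stay))
    | none =>
      some (.rewind, .stay, fun i => (r₁ i, .stay), (v, .stay), fun i => (r₂ i, .stay))
  | .rewind =>
    if s = .leftEnd ∧ atStart = true then
      some (.copy, .right, fun i => (r₁ i, .stay), (v, .stay), fun i => (r₂ i, .stay))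
    else
      some (.rewind, .left, fun i => (r₁ i, .left), (v, .stay), fun i => (r₂ i, .stay))
  | .copy =>
    if r₁ P.j = P.G.blank then
      some (.back, .stay, fun i => (r₁ i, .stay), (v, .stay), fun i => (r₂ i, .stay))
    else
      some (.copy, .right, fun i => (r₁ i, .right), (P.h s, .right), fun i => (r₂ i, .stay))
  | .back =>
    if v = .leftEnd then
      some (.simulate P.N.start (Fin.last P.K), .stay, fun i => (r₁ i, .stay), (v, .stay),
        fun i => (r₂ i, .stay))
    else
      some (.back, .stay, fun i => (r₁ i, .stay), (v, .left), fun i => (r₂ i, .stay))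
  | .simulate q c =>
    match P.N.δ q v r₂ with
    | none => none
    | some (q', m, a) =>
      if c = 0 then
        if atStart = true then
          if P.clocked then
            some (.timeout, .stay, fun i => (r₁ i, .stay), (v, .stay), fun i => (r₂ i, .stay))
          else some (.simulate q' 0, .stay, fun i => (r₁ i, .stay), (v, m.clamp v), a)
        else some (.simulate q' (Fin.last P.K), .stay, fun i => (r₁ i, .left), (v, m.clamp v), a)
      else some (.simulate q' (c - 1), .stay, fun i => (r₁ i, .stay), (v, m.clamp v), a)
  | .timeout => none

/-- The machine of the pipeline.  In its first step, it marks the leftmost cells of the tapes of `G`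
and of the virtual input tape. -/
noncomputable def machine [Finite β] : DTM α (numTapes b₁ b₂) where
  Q := Option P.State
  Γ := P.Symbol
  finite_Q := by
    have := P.G.finite_Q
    have := P.N.finite_Q
    infer_instance
  finite_Γ := by
    have := P.G.finite_Γ
    have := P.N.finite_Γ
    infer_instance
  blank := ((P.G.blank, false), .rightEnd, P.N.blank)
  start := none
  accepting := {st | ∃ q c, st = some (.simulate q c) ∧ q ∈ P.N.accepting}
  δ st s r :=
    match st with
    | none => some (some (.generate P.G.start), .stay,
        Sum.elim (fun _ => (((P.G.blank, true), .rightEnd, P.N.blank), .stay))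
          (Sum.elim (fun _ => (((P.G.blank, false), .rightEnd, P.N.blank), .stay))
            (fun _ => (((P.G.blank, false), .leftEnd, P.N.blank), .right)))
          ∘ (tapeEquiv b₁ b₂).symm)
    | some st =>
      (P.control st s (fun i => (r (tapeEquiv b₁ b₂ (.inl i))).1.1)
        (r (tapeEquiv b₁ b₂ (.inl P.j))).1.2
        (r (tapeEquiv b₁ b₂ (.inr (.inr ())))).2.1
        (fun i => (r (tapeEquiv b₁ b₂ (.inr (.inl i)))).2.2)).map
      fun (st', m, a₁, av, a₂) => (some st', m,
        Sum.elim (fun i => ((((a₁ i).1, (r (tapeEquiv b₁ b₂ (.inl i))).1.2), .rightEnd, P.N.blank),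
            (a₁ i).2))
          (Sum.elim (fun i => (((P.G.blank, false), .rightEnd, (a₂ i).1), (a₂ i).2))
            (fun _ => (((P.G.blank, false), av.1, P.N.blank), av.2)))
          ∘ (tapeEquiv b₁ b₂).symm)

/-- A configuration after the first step: stage, input head, heads and tapes of `G`, head and
contents of the virtual input tape, heads and tapes of `N`. -/
structure View where
  state : P.State
  inputHead : ℕ
  head₁ : Fin b₁ → ℕ
  tape₁ : Fin b₁ → ℕ → P.G.Γ
  headV : ℕ
  tapeV : ℕ → InputSymbol β
  head₂ : Fin b₂ → ℕ
  tape₂ : Fin b₂ → ℕ → P.N.Γ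

variable {P}

/-- What the machine does next, in terms of a view. -/
noncomputable def View.action (w : List α) (c : P.View) :
    Option (P.State × HeadMove × P.TapeActions) :=
  P.control c.state (inputSymbolAt w c.inputHead) (fun i => c.tape₁ i (c.head₁ i))
    (decide (c.head₁ P.j = 0)) (c.tapeV c.headV) (fun i => c.tape₂ i (c.head₂ i))

/-- One step, in terms of a view. -/
noncomputable def View.step (w : List α) (c : P.View) : P.View :=
  match c.action w with
  | none => c
  | some (st, m, a₁, av, a₂) =>
    { state := st
      inputHead := min (m.apply c.inputHead) (w.length + 1)
      head₁ := fun i => (a₁ i).2.apply (c.head₁ i)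
      tape₁ := fun i => Function.update (c.tape₁ i) (c.head₁ i) (a₁ i).1
      headV := av.2.apply c.headV
      tapeV := Function.update c.tapeV c.headV av.1
      head₂ := fun i => (a₂ i).2.apply (c.head₂ i)
      tape₂ := fun i => Function.update (c.tape₂ i) (c.head₂ i) (a₂ i).1 }

/-- The configuration described by a view. -/
noncomputable def View.toCfg [Finite β] (c : P.View) : P.machine.Cfg where
  state := some c.state
  inputHead := c.inputHead
  head := Sum.elim c.head₁ (Sum.elim c.head₂ fun _ => c.headV) ∘ (tapeEquiv b₁ b₂).symm
  tape := (Sum.elim (fun i p => ((c.tape₁ i p, decide (p = 0)), .rightEnd, P.N.blank))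
    (Sum.elim (fun i p => ((P.G.blank, false), .rightEnd, c.tape₂ i p))
      fun _ p => ((P.G.blank, false), c.tapeV p, P.N.blank)) ∘ (tapeEquiv b₁ b₂).symm :
        Fin (numTapes b₁ b₂) → ℕ → P.Symbol)

theorem View.action_toCfg [Finite β] (w : List α) (c : P.View) :
    P.machine.action w c.toCfg = (c.action w).map
      fun (st', m, a₁, av, a₂) => (some st', m,
        Sum.elim (fun i => ((((a₁ i).1, decide (c.head₁ i = 0)), .rightEnd, P.N.blank),
            (a₁ i).2))
          (Sum.elim (fun i => (((P.G.blank, false), .rightEnd, (a₂ i).1), (a₂ i).2))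
            (fun _ => (((P.G.blank, false), av.1, P.N.blank), av.2)))
          ∘ (tapeEquiv b₁ b₂).symm) := by
  simp [DTM.action, machine, View.action, View.toCfg]

theorem View.halted_toCfg_iff [Finite β] {w : List α} {c : P.View} :
    P.machine.Halted w c.toCfg ↔ c.action w = none := by
  rw [DTM.Halted, View.action_toCfg]
  simp

theorem View.step_toCfg [Finite β] (w : List α) (c : P.View) :
    P.machine.step w c.toCfg = (c.step w).toCfg := by
  have hact := View.action_toCfg w c
  rcases h : c.action w with _ | ⟨st, m, a₁, av, a₂⟩
  · rw [h] at hact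
    rw [DTM.step_of_action_eq_none hact, View.step, h]
  · rw [h] at hact
    rw [DTM.step_of_action_eq_some hact, View.step, h]
    refine DTM.Cfg.ext_fields rfl rfl ?_ ?_ <;> funext i <;>
      simp only [View.toCfg, Function.comp_apply] <;>
      generalize (tapeEquiv b₁ b₂).symm i = k
    · rcases k with i | i | i <;> rfl
    · rcases k with i | i | i
      · exact update_comp (fun p (a : P.G.Γ) =>
          ((a, decide (p = 0)), (.rightEnd : InputSymbol β), P.N.blank)) _ _ _
      · exact update_comp (fun _ (a : P.N.Γ) =>
          ((P.G.blank, false), (.rightEnd : InputSymbol β), a)) _ _ _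
      · exact update_comp (fun _ (a : InputSymbol β) => ((P.G.blank, false), a, P.N.blank)) _ _ _

theorem View.iterate_step_toCfg [Finite β] (w : List α) (c : P.View) (n : ℕ) :
    (P.machine.step w)^[n] c.toCfg = ((View.step w)^[n] c).toCfg := by
  induction n with
  | zero => rfl
  | succ n ih => rw [Function.iterate_succ_apply', ih, step_toCfg, Function.iterate_succ_apply']

variable (P)

/-- The view after the first step. -/
def initialView : P.View where
  state := .generate P.G.start
  inputHead := 0
  head₁ := fun _ => 0
  tape₁ := fun _ _ => P.G.blank
  headV := 1
  tapeV := fun p => if p = 0 then .leftEnd else .rightEnd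
  head₂ := fun _ => 0
  tape₂ := fun _ _ => P.N.blank

theorem run_one [Finite β] (w : List α) : P.machine.run w 1 = P.initialView.toCfg := by
  rw [DTM.run_succ, DTM.run_zero, DTM.step_of_action_eq_some (by rfl)]
  refine DTM.Cfg.ext_fields rfl
      (by simp [HeadMove.apply, View.toCfg, initialView, DTM.init]) ?_ ?_ <;>
    simp only [View.toCfg, initialView, DTM.init, machine] <;> funext i <;>
    obtain ⟨i, rfl⟩ := (tapeEquiv b₁ b₂).surjective i
  · rcases i with i | i | i <;> simp [HeadMove.apply]
  · rcases i with i | i | i <;> funext p <;>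
        simp only [Function.comp_apply, Equiv.symm_apply_apply, Sum.elim_inl, Sum.elim_inr,
          Function.update_apply] <;> split_ifs <;> simp_all

/-- The contents of the virtual input tape after `k` letters have been copied. -/
def virtualTape (w : List α) (k p : ℕ) : InputSymbol β :=
  if p = 0 then .leftEnd else if p ≤ k then P.h (inputSymbolAt w p) else .rightEnd

/-- A view in which nothing has happened on the tapes of `N`. -/
def layoutView (st : P.State) (inputHead : ℕ) (head₁ : Fin b₁ → ℕ) (tape₁ : Fin b₁ → ℕ → P.G.Γ)
    (headV : ℕ) (tapeV : ℕ → InputSymbol β) : P.View where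
  state := st
  inputHead := inputHead
  head₁ := head₁
  tape₁ := tape₁
  headV := headV
  tapeV := tapeV
  head₂ := fun _ => 0
  tape₂ := fun _ _ => P.N.blank

variable {P} {w : List α}

theorem View.step_of_action_eq_some {c : P.View} {st : P.State} {m : HeadMove}
    {a₁ : Fin b₁ → P.G.Γ × HeadMove} {av : InputSymbol β × HeadMove}
    {a₂ : Fin b₂ → P.N.Γ × HeadMove} (h : c.action w = some (st, m, a₁, av, a₂)) :
    c.step w =
      { state := st
        inputHead := min (m.apply c.inputHead) (w.length + 1)
        head₁ := fun i => (a₁ i).2.apply (c.head₁ i)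
        tape₁ := fun i => Function.update (c.tape₁ i) (c.head₁ i) (a₁ i).1
        headV := av.2.apply c.headV
        tapeV := Function.update c.tapeV c.headV av.1
        head₂ := fun i => (a₂ i).2.apply (c.head₂ i)
        tape₂ := fun i => Function.update (c.tape₂ i) (c.head₂ i) (a₂ i).1 } := by
  simp [step, h]

theorem step_layoutView {st st' : P.State} {ih v : ℕ} {h₁ : Fin b₁ → ℕ} {t₁ : Fin b₁ → ℕ → P.G.Γ}
    {V : ℕ → InputSymbol β} {m : HeadMove} {a₁ : Fin b₁ → P.G.Γ × HeadMove}
    {av : InputSymbol β × HeadMove}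
    (h : P.control st (inputSymbolAt w ih) (fun i => t₁ i (h₁ i)) (decide (h₁ P.j = 0)) (V v)
      (fun _ => P.N.blank) = some (st', m, a₁, av, fun _ => (P.N.blank, .stay))) :
    (P.layoutView st ih h₁ t₁ v V).step w =
      P.layoutView st' (min (m.apply ih) (w.length + 1)) (fun i => (a₁ i).2.apply (h₁ i))
        (fun i => Function.update (t₁ i) (h₁ i) (a₁ i).1) (av.2.apply v)
        (Function.update V v av.1) := by
  rw [View.step_of_action_eq_some (c := P.layoutView st ih h₁ t₁ v V) h]
  simp [layoutView, HeadMove.apply]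

theorem iterate_step_generate (n : ℕ) (hn : ∀ k < n, ¬ P.G.Halted w (P.G.run w k)) :
    (View.step w)^[n] P.initialView =
      P.layoutView (.generate (P.G.run w n).state) (P.G.run w n).inputHead (P.G.run w n).head
        (P.G.run w n).tape 1 (P.virtualTape w 0) := by
  induction n with
  | zero =>
    simp only [Function.iterate_zero, id, initialView, layoutView, DTM.run_zero, DTM.init,
      View.mk.injEq, true_and, and_true]
    funext p
    cases p <;> simp [virtualTape]
  | succ n ih =>
    rw [Function.iterate_succ_apply', ih fun k hk => hn k (hk.trans n.lt_succ_self), DTM.run_succ]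
    have hne := hn n n.lt_succ_self
    generalize P.G.run w n = c at *
    rcases h : P.G.action w c with _ | ⟨q, m, a⟩
    · exact absurd h hne
    · rw [DTM.step_of_action_eq_some h, step_layoutView (st' := .generate q) (m := m) (a₁ := a)
        (av := (P.virtualTape w 0 1, .stay))]
      · simp [HeadMove.apply]
      · unfold DTM.action at h
        simp [control, h]

theorem step_generate_of_halted {c : P.G.Cfg} (hc : P.G.Halted w c)
    (hle : c.inputHead ≤ w.length + 1) (v : ℕ) (V : ℕ → InputSymbol β) :
    (P.layoutView (.generate c.state) c.inputHead c.head c.tape v V).step w =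
      P.layoutView .rewind c.inputHead c.head c.tape v V := by
  rw [step_layoutView (st' := .rewind) (m := .stay) (a₁ := fun i => (c.tape i (c.head i), .stay))
    (av := (V v, .stay))]
  · simp [HeadMove.apply, hle]
  · unfold DTM.Halted DTM.action at hc
    simp [control, hc]

theorem exists_iterate_step_rewind (t₁ : Fin b₁ → ℕ → P.G.Γ) (v : ℕ) (V : ℕ → InputSymbol β)
    (n : ℕ) : ∀ (ih : ℕ) (h₁ : Fin b₁ → ℕ), ih ≤ n → h₁ P.j ≤ n → ih ≤ w.length + 1 →
    ∃ k ≤ n + 1, ∃ h₁' : Fin b₁ → ℕ, h₁' P.j = 0 ∧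
      (View.step w)^[k] (P.layoutView .rewind ih h₁ t₁ v V) = P.layoutView .copy 1 h₁' t₁ v V := by
  induction n with
  | zero =>
    intro ih h₁ hih hj _
    obtain rfl : ih = 0 := by omega
    refine ⟨1, le_rfl, h₁, by omega, ?_⟩
    rw [Function.iterate_one, step_layoutView (st' := .copy) (m := .right)
      (a₁ := fun i => (t₁ i (h₁ i), .stay)) (av := (V v, .stay))]
    · simp [HeadMove.apply]
    · simp [control, Nat.le_zero.1 hj]
  | succ n IH =>
    intro ih h₁ hih hj hle
    by_cases h0 : ih = 0 ∧ h₁ P.j = 0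
    · obtain ⟨k, hk, h⟩ := IH ih h₁ (by omega) (by omega) hle
      exact ⟨k, by omega, h⟩
    · obtain ⟨k, hk, h₁', hz, h⟩ := IH (ih - 1) (fun i => h₁ i - 1) (by omega)
        (by omega) (by omega)
      refine ⟨k + 1, by omega, h₁', hz, ?_⟩
      rw [Function.iterate_succ_apply, step_layoutView (st' := .rewind) (m := .left)
        (a₁ := fun i => (t₁ i (h₁ i), .left)) (av := (V v, .stay)), ← h]
      · simp only [HeadMove.apply, Function.update_eq_self]
        rw [min_eq_left (by omega)]
      · simp only [control, inputSymbolAt_eq_leftEnd_iff, decide_eq_true_eq, if_neg h0]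

theorem iterate_step_copy {t₁ : Fin b₁ → ℕ → P.G.Γ} {h₁ : Fin b₁ → ℕ} (hj : h₁ P.j = 0) {m : ℕ}
    (ht : ∀ p < m, t₁ P.j p ≠ P.G.blank) {k : ℕ} (hk : k ≤ m) :
    (View.step w)^[k] (P.layoutView .copy 1 h₁ t₁ 1 (P.virtualTape w 0)) =
      P.layoutView .copy (min (k + 1) (w.length + 1)) (fun i => h₁ i + k) t₁ (k + 1)
        (P.virtualTape w k) := by
  induction k with
  | zero => simp
  | succ k ih =>
    rw [Function.iterate_succ_apply', ih (by omega), step_layoutView (st' := .copy) (m := .right)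
      (a₁ := fun i => (t₁ i (h₁ i + k), .right)) (av := (P.h (inputSymbolAt w (k + 1)), .right))]
    · simp only [HeadMove.apply, Function.update_eq_self]
      congr 1
      · omega
      · funext p
        simp only [Function.update_apply, virtualTape]
        split_ifs <;> first | rfl | omega | simp_all
    · simp [-Nat.add_min_add_right, control, hj, ht k (by omega), inputSymbolAt_min]

theorem step_copy_of_blank {t₁ : Fin b₁ → ℕ → P.G.Γ} {h₁ : Fin b₁ → ℕ}
    (h : t₁ P.j (h₁ P.j) = P.G.blank) {ih : ℕ} (hle : ih ≤ w.length + 1) (v : ℕ)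
    (V : ℕ → InputSymbol β) :
    (P.layoutView .copy ih h₁ t₁ v V).step w = P.layoutView .back ih h₁ t₁ v V := by
  rw [step_layoutView (st' := .back) (m := .stay) (a₁ := fun i => (t₁ i (h₁ i), .stay))
    (av := (V v, .stay))]
  · simp [HeadMove.apply, hle]
  · simp [control, h]

theorem iterate_step_back {t₁ : Fin b₁ → ℕ → P.G.Γ} {h₁ : Fin b₁ → ℕ} {ih : ℕ}
    (hle : ih ≤ w.length + 1) (k v : ℕ) :
    (View.step w)^[v + 1] (P.layoutView .back ih h₁ t₁ v (P.virtualTape w k)) =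
      P.layoutView (.simulate P.N.start (Fin.last P.K)) ih h₁ t₁ 0 (P.virtualTape w k) := by
  induction v with
  | zero =>
    rw [zero_add, Function.iterate_one,
      step_layoutView (st' := .simulate P.N.start (Fin.last P.K)) (m := .stay)
        (a₁ := fun i => (t₁ i (h₁ i), .stay)) (av := (P.virtualTape w k 0, .stay))]
    · simp [HeadMove.apply, hle]
    · simp [control, virtualTape]
  | succ v IH =>
    rw [Function.iterate_succ_apply, step_layoutView (st' := .back) (m := .stay)
        (a₁ := fun i => (t₁ i (h₁ i), .stay)) (av := (P.virtualTape w k (v + 1), .left)), ← IH]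
    · simp [HeadMove.apply, hle]
    · have hne : P.virtualTape w k (v + 1) ≠ .leftEnd := by
        simp only [virtualTape, Nat.add_eq_zero_iff, one_ne_zero, and_false, if_false]
        split_ifs
        · exact P.h_ne _
        · simp
      simp [control, hne]

/-- The unary word on tape `j` and the virtual input tape are laid out in linear time. -/
theorem exists_run_layout [Finite β] {T m : ℕ} (hT : P.G.Halted w (P.G.run w T))
    {one : P.G.Γ} (hone : one ≠ P.G.blank)
    (htape : ∀ p, (P.G.run w T).tape P.j p = if p < m then one else P.G.blank) :
    ∃ n ≤ 2 * T + 2 * m + 8, ∃ (ih : ℕ) (h₁ : Fin b₁ → ℕ) (t₁ : Fin b₁ → ℕ → P.G.Γ),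
      ih ≤ w.length + 1 ∧ h₁ P.j = m ∧ P.machine.run w n =
        (P.layoutView (.simulate P.N.start (Fin.last P.K)) ih h₁ t₁ 0
          (P.virtualTape w m)).toCfg := by
  obtain ⟨T', hTT', hT', hrun, hmin⟩ := DTM.exists_first_halted hT
  rw [hrun] at htape
  have hle := P.G.inputHead_run_le_length (w := w) T'
  have hgen := iterate_step_generate T' hmin
  have hheads := P.G.heads_run_le (w := w) T'
  generalize P.G.run w T' = c at *
  obtain ⟨k, hk, h₁, hz, hrew⟩ := exists_iterate_step_rewind (P := P) (w := w) c.tape 1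
    (P.virtualTape w 0) T' c.inputHead c.head hheads.1 (hheads.2 _) hle
  have hcopy := iterate_step_copy (P := P) (w := w) hz (t₁ := c.tape) (m := m)
    (fun p hp => by rwa [htape, if_pos hp]) le_rfl
  have hend := step_copy_of_blank (P := P) (w := w) (t₁ := c.tape) (h₁ := fun i => h₁ i + m)
    (by simp [htape, hz]) (min_le_right (m + 1) _) (m + 1) (P.virtualTape w m)
  have hback := iterate_step_back (P := P) (w := w) (t₁ := c.tape) (h₁ := fun i => h₁ i + m)
    (min_le_right (m + 1) _) m (m + 1)
  refine ⟨(m + 1 + 1) + (1 + (m + (k + (1 + (T' + 1))))), by omega, _, fun i => h₁ i + m, c.tape,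
    min_le_right (m + 1) _, by simp [hz], ?_⟩
  have h1 : P.machine.run w (T' + 1) = ((View.step w)^[T'] P.initialView).toCfg := by
    rw [DTM.run, Function.iterate_add_apply, ← View.iterate_step_toCfg, ← run_one, DTM.run]
  rw [DTM.run] at h1
  rw [DTM.run, Function.iterate_add_apply _ (m + 1 + 1), Function.iterate_add_apply _ 1,
    Function.iterate_add_apply _ m, Function.iterate_add_apply _ k, Function.iterate_add_apply _ 1,
    h1]
  simp only [View.iterate_step_toCfg]
  rw [hgen, Function.iterate_one, step_generate_of_halted hT' hle, hrew, hcopy, hend, hback]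

variable (P) in
/-- A view in which the configuration `c` of `N` has been reached by the simulation. -/
def simulateView (c : P.N.Cfg) (k : Fin (P.K + 1)) (ih : ℕ) (h₁ : Fin b₁ → ℕ)
    (t₁ : Fin b₁ → ℕ → P.G.Γ) (V : ℕ → InputSymbol β) : P.View where
  state := .simulate c.state k
  inputHead := ih
  head₁ := h₁
  tape₁ := t₁
  headV := c.inputHead
  tapeV := V
  head₂ := c.head
  tape₂ := c.tape

theorem action_simulateView {x : List β} {V : ℕ → InputSymbol β}
    (hV : ∀ p ≤ x.length + 1, V p = inputSymbolAt x p) {c : P.N.Cfg}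
    (hc : c.inputHead ≤ x.length + 1) {k : Fin (P.K + 1)} {ih : ℕ} {h₁ : Fin b₁ → ℕ}
    {t₁ : Fin b₁ → ℕ → P.G.Γ} :
    (P.simulateView c k ih h₁ t₁ V).action w = none ↔ P.N.Halted x c := by
  unfold DTM.Halted DTM.action
  simp only [View.action, control, simulateView, hV _ hc]
  split
  · simp [*]
  · simp only [*, reduceCtorEq, iff_false]
    split_ifs <;> simp

theorem step_simulateView {x : List β} {V : ℕ → InputSymbol β}
    (hV : ∀ p ≤ x.length + 1, V p = inputSymbolAt x p) {c : P.N.Cfg}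
    (hc : c.inputHead ≤ x.length + 1) (hne : ¬ P.N.Halted x c) {k : Fin (P.K + 1)} {ih : ℕ}
    (hih : ih ≤ w.length + 1) {h₁ : Fin b₁ → ℕ} {t₁ : Fin b₁ → ℕ → P.G.Γ}
    (hclock : P.clocked → h₁ P.j * (P.K + 1) + k ≠ 0) :
    ∃ (k' : Fin (P.K + 1)) (h₁' : Fin b₁ → ℕ),
      h₁' P.j * (P.K + 1) + k' = h₁ P.j * (P.K + 1) + k - 1 ∧
      (P.simulateView c k ih h₁ t₁ V).step w =
        P.simulateView (P.N.step x c) k' ih h₁' t₁ V := by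
  rcases ha : P.N.action x c with _ | ⟨q, m, a⟩
  · exact absurd ha hne
  have hmove : min (m.apply c.inputHead) (x.length + 1) =
      (m.clamp (V c.inputHead)).apply c.inputHead := by
    rw [hV _ hc, HeadMove.clamp_apply _ _ hc]
  have hδ : P.N.δ c.state (V c.inputHead) (fun i => c.tape i (c.head i)) = some (q, m, a) := by
    rw [hV _ hc]; exact ha
  rw [DTM.step_of_action_eq_some ha]
  by_cases hk : k = 0
  · subst hk
    by_cases hz : h₁ P.j = 0
    · have hcl : ¬ P.clocked := fun h => hclock h (by simp [hz])
      refine ⟨0, h₁, by simp [hz], ?_⟩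
      rw [View.step_of_action_eq_some (st := .simulate q 0) (m := .stay)
        (a₁ := fun i => (t₁ i (h₁ i), .stay))
        (av := (V c.inputHead, m.clamp (V c.inputHead))) (a₂ := a)]
      · simp [simulateView, hmove, hih]
      · simp [View.action, control, simulateView, hδ, hz, hcl]
    · refine ⟨Fin.last P.K, fun i => h₁ i - 1, ?_, ?_⟩
      · obtain ⟨r, hr⟩ := Nat.exists_eq_succ_of_ne_zero hz
        simp only [hr, Fin.val_last, Nat.succ_sub_one, Fin.val_zero, Nat.succ_mul]
        omega
      rw [View.step_of_action_eq_some (st := .simulate q (Fin.last P.K)) (m := .stay)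
        (a₁ := fun i => (t₁ i (h₁ i), .left))
        (av := (V c.inputHead, m.clamp (V c.inputHead))) (a₂ := a)]
      · simp [simulateView, hmove, hih]
      · simp [View.action, control, simulateView, hδ, hz]
  · refine ⟨k - 1, h₁, ?_, ?_⟩
    · rw [Fin.val_sub_one_of_ne_zero hk]
      have := Fin.val_ne_zero_iff.2 hk
      omega
    rw [View.step_of_action_eq_some (st := .simulate q (k - 1)) (m := .stay)
      (a₁ := fun i => (t₁ i (h₁ i), .stay))
      (av := (V c.inputHead, m.clamp (V c.inputHead))) (a₂ := a)]
    · simp [simulateView, hmove, hih]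
    · simp [View.action, control, simulateView, hδ, hk]

theorem step_simulateView_timeout {x : List β} {V : ℕ → InputSymbol β}
    (hV : ∀ p ≤ x.length + 1, V p = inputSymbolAt x p) {c : P.N.Cfg}
    (hc : c.inputHead ≤ x.length + 1) (hne : ¬ P.N.Halted x c) {k : Fin (P.K + 1)} {ih : ℕ}
    {h₁ : Fin b₁ → ℕ} {t₁ : Fin b₁ → ℕ → P.G.Γ} (hcl : P.clocked)
    (hclock : h₁ P.j * (P.K + 1) + k = 0) :
    ((P.simulateView c k ih h₁ t₁ V).step w).state = .timeout := by
  rcases ha : P.N.action x c with _ | ⟨q, m, a⟩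
  · exact absurd ha hne
  have hδ : P.N.δ c.state (V c.inputHead) (fun i => c.tape i (c.head i)) = some (q, m, a) := by
    rw [hV _ hc]; exact ha
  have hk : k = 0 := by
    rw [← Fin.val_eq_zero_iff]; omega
  have hz : h₁ P.j = 0 := by
    by_contra h
    have : 0 < h₁ P.j * (P.K + 1) := Nat.mul_pos (Nat.pos_of_ne_zero h) P.K.succ_pos
    omega
  rw [View.step_of_action_eq_some (st := .timeout) (m := .stay)
    (a₁ := fun i => (t₁ i (h₁ i), .stay))
    (av := (V c.inputHead, .stay)) (a₂ := fun i => (c.tape i (c.head i), .stay))]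
  simp [View.action, control, simulateView, hδ, hk, hz, hcl]

theorem iterate_step_simulateView {x : List β} {V : ℕ → InputSymbol β}
    (hV : ∀ p ≤ x.length + 1, V p = inputSymbolAt x p) {ih : ℕ} (hih : ih ≤ w.length + 1)
    (h₁ : Fin b₁ → ℕ) (t₁ : Fin b₁ → ℕ → P.G.Γ) (n : ℕ)
    (hn : ∀ k < n, ¬ P.N.Halted x (P.N.run x k))
    (hclock : P.clocked → n ≤ h₁ P.j * (P.K + 1) + P.K) :
    ∃ (k : Fin (P.K + 1)) (h₁' : Fin b₁ → ℕ),
      h₁' P.j * (P.K + 1) + k = h₁ P.j * (P.K + 1) + P.K - n ∧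
      (View.step w)^[n] (P.simulateView P.N.init (Fin.last P.K) ih h₁ t₁ V) =
        P.simulateView (P.N.run x n) k ih h₁' t₁ V := by
  induction n with
  | zero => exact ⟨Fin.last P.K, h₁, by simp, rfl⟩
  | succ n IH =>
    obtain ⟨k, h₁', hf, h⟩ := IH (fun k hk => hn k (by omega)) (fun h => by have := hclock h; omega)
    obtain ⟨k', h₁'', hf', h'⟩ := step_simulateView (P := P) (w := w) hV
      (P.N.inputHead_run_le_length (w := x) n) (hn n n.lt_succ_self) hih (k := k) (h₁ := h₁')
      (t₁ := t₁) (fun h => by have := hclock h; omega)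
    refine ⟨k', h₁'', by omega, ?_⟩
    rw [Function.iterate_succ_apply', h, h', DTM.run_succ]

section Run

variable [Finite β] {T m : ℕ} {one : P.G.Γ} {x : List β}

/-- If the simulated machine halts, and this is not prevented by the clock, then its result is the
result of the pipeline. -/
theorem exists_run_of_halted (hT : P.G.Halted w (P.G.run w T)) (hone : one ≠ P.G.blank)
    (htape : ∀ p, (P.G.run w T).tape P.j p = if p < m then one else P.G.blank)
    (hx : ∀ p ≤ x.length + 1, P.virtualTape w m p = inputSymbolAt x p) {S : ℕ}
    (hS : P.N.Halted x (P.N.run x S)) (hclock : P.clocked → S ≤ m * (P.K + 1) + P.K) {t : ℕ}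
    (ht : 2 * T + 2 * m + 8 + S ≤ t) :
    P.machine.Halted w (P.machine.run w t) ∧ ∃ k ih h₁ t₁ V,
      P.machine.run w t = (P.simulateView (P.N.run x S) k ih h₁ t₁ V).toCfg := by
  obtain ⟨n, hn, ih, h₁, t₁, hih, hj, hrun⟩ := exists_run_layout hT hone htape
  obtain ⟨S', hS', hhalt, heq, hmin⟩ := DTM.exists_first_halted hS
  obtain ⟨k, h₁', -, h⟩ := iterate_step_simulateView (P := P) (w := w) hx hih h₁ t₁ S' hmin
    (fun h => by rw [hj]; exact hS'.trans (hclock h))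
  have hfin : P.machine.run w (S' + n) =
      (P.simulateView (P.N.run x S) k ih h₁' t₁ (P.virtualTape w m)).toCfg := by
    rw [heq, ← h, ← View.iterate_step_toCfg, DTM.run, Function.iterate_add_apply]
    exact congrArg _ hrun
  have hh : P.machine.Halted w (P.machine.run w (S' + n)) := by
    rw [hfin, View.halted_toCfg_iff,
      action_simulateView hx (P.N.inputHead_run_le_length S)]
    exact hS
  rw [DTM.run_eq_of_halted hh (by omega)]
  exact ⟨hh, k, ih, h₁', t₁, _, hfin⟩

/-- If the simulated machine does not halt in the time allowed by the clock, then the pipeline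
halts without accepting. -/
theorem exists_run_of_timeout (hT : P.G.Halted w (P.G.run w T)) (hone : one ≠ P.G.blank)
    (htape : ∀ p, (P.G.run w T).tape P.j p = if p < m then one else P.G.blank)
    (hx : ∀ p ≤ x.length + 1, P.virtualTape w m p = inputSymbolAt x p) (hcl : P.clocked)
    (hS : ¬ P.N.Halted x (P.N.run x (m * (P.K + 1) + P.K))) {t : ℕ}
    (ht : 2 * T + 2 * m + 9 + (m * (P.K + 1) + P.K) ≤ t) :
    P.machine.Halted w (P.machine.run w t) ∧
      (P.machine.run w t).state ∉ P.machine.accepting := by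
  obtain ⟨n, hn, ih, h₁, t₁, hih, hj, hrun⟩ := exists_run_layout hT hone htape
  obtain ⟨k, h₁', hf, h⟩ := iterate_step_simulateView (P := P) (w := w) hx hih h₁ t₁
    (m * (P.K + 1) + P.K)
    (fun k hk hk' => hS (by rw [DTM.run_eq_of_halted hk' hk.le]; exact hk'))
    (fun h => by rw [hj])
  have hst := step_simulateView_timeout (P := P) (w := w) hx
    (P.N.inputHead_run_le_length (w := x) (m * (P.K + 1) + P.K)) hS (k := k) (ih := ih) (h₁ := h₁')
    (t₁ := t₁) hcl (by rw [hf, hj, Nat.sub_self])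
  rw [← h] at hst
  have hfin : P.machine.run w (1 + ((m * (P.K + 1) + P.K) + n)) =
      (View.step w ((View.step w)^[m * (P.K + 1) + P.K]
        (P.simulateView P.N.init (Fin.last P.K) ih h₁ t₁ (P.virtualTape w m)))).toCfg := by
    rw [← View.step_toCfg, ← View.iterate_step_toCfg, DTM.run, Function.iterate_add_apply,
      Function.iterate_one, Function.iterate_add_apply]
    exact congrArg (fun c => P.machine.step w ((P.machine.step w)^[m * (P.K + 1) + P.K] c)) hrun
  generalize View.step w ((View.step w)^[m * (P.K + 1) + P.K] _) = c at hst hfin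
  have hh : P.machine.Halted w (P.machine.run w (1 + ((m * (P.K + 1) + P.K) + n))) := by
    rw [hfin, View.halted_toCfg_iff, View.action, hst]
    rfl
  rw [DTM.run_eq_of_halted hh (by omega)]
  refine ⟨hh, ?_⟩
  rw [hfin]
  rintro ⟨q, c', h, -⟩
  simp [View.toCfg, hst] at h

theorem state_toCfg_mem_accepting {c : P.N.Cfg} {k : Fin (P.K + 1)} {ih : ℕ} {h₁ : Fin b₁ → ℕ}
    {t₁ : Fin b₁ → ℕ → P.G.Γ} {V : ℕ → InputSymbol β} :
    (P.simulateView c k ih h₁ t₁ V).toCfg.state ∈ P.machine.accepting ↔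
      c.state ∈ P.N.accepting := by
  constructor
  · rintro ⟨q, c', h, hq⟩
    simp only [View.toCfg, simulateView, Option.some.injEq, Stage.simulate.injEq] at h
    exact h.1 ▸ hq
  · exact fun h => ⟨_, _, rfl, h⟩

end Run

end Pipeline

theorem inBigO_iff {t f : ℕ → ℕ} : InBigO t f ↔ ∃ C : ℕ, ∀ᶠ n in atTop, t n ≤ C * f n := by
  constructor
  · intro h
    obtain ⟨c, hc⟩ := h.bound
    refine ⟨⌈c⌉₊, hc.mono fun n hn => ?_⟩
    rw [Real.norm_natCast, Real.norm_natCast] at hn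
    have : (t n : ℝ) ≤ ⌈c⌉₊ * f n :=
      hn.trans (mul_le_mul_of_nonneg_right (Nat.le_ceil c) (Nat.cast_nonneg _))
    exact_mod_cast this
  · rintro ⟨C, hC⟩
    refine IsBigO.of_bound C (hC.mono fun n hn => ?_)
    rw [Real.norm_natCast, Real.norm_natCast]
    exact_mod_cast hn

namespace InBigO

variable {s t f g : ℕ → ℕ}

theorem of_le (h : ∀ n, t n ≤ f n) : InBigO t f :=
  inBigO_iff.2 ⟨1, Eventually.of_forall fun n => by simpa using h n⟩

theorem trans (h : InBigO s t) (h' : InBigO t f) : InBigO s f := IsBigO.trans h h'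

theorem add (hs : InBigO s f) (ht : InBigO t f) : InBigO (fun n => s n + t n) f := by
  simpa [InBigO] using IsBigO.add hs ht

theorem const_mul (c : ℕ) (h : InBigO t f) : InBigO (fun n => c * t n) f := by
  simpa [InBigO] using IsBigO.const_mul_left h (c : ℝ)

theorem const (c : ℕ) (hf : ∀ n, n ≤ f n) : InBigO (fun _ => c) f :=
  inBigO_iff.2 ⟨1, (eventually_ge_atTop c).mono fun n hn => by simpa using hn.trans (hf n)⟩

theorem comp (h : InBigO t f) (hg : Tendsto g atTop atTop) : InBigO (t ∘ g) (f ∘ g) :=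
  IsBigO.comp_tendsto h hg

theorem exists_forall_le (h : InBigO t f) : ∃ K : ℕ, ∀ n, t n ≤ f n * (K + 1) + K := by
  obtain ⟨C, hC⟩ := inBigO_iff.1 h
  obtain ⟨n₀, hn₀⟩ := eventually_atTop.1 hC
  refine ⟨C + ∑ n ∈ Finset.range n₀, t n, fun n => ?_⟩
  rcases lt_or_ge n n₀ with hn | hn
  · have := Finset.single_le_sum (f := t) (fun _ _ => Nat.zero_le _) (Finset.mem_range.2 hn)
    exact (this.trans (Nat.le_add_left _ _)).trans (Nat.le_add_left _ _)
  · refine (hn₀ n hn).trans (le_trans ?_ (Nat.le_add_right _ _))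
    rw [mul_comm]
    exact Nat.mul_le_mul_left _ (by omega)

end InBigO

namespace IsTimeBound

variable {f g : ℕ → ℕ}

theorem le (hf : IsTimeBound f) (n : ℕ) : n ≤ f n := (hf n).1

theorem monotone (hf : IsTimeBound f) : Monotone f := monotone_nat_of_le_succ fun n => (hf n).2

theorem tendsto_atTop (hf : IsTimeBound f) : Tendsto f atTop atTop :=
  tendsto_atTop_mono hf.le tendsto_id

theorem comp (hf : IsTimeBound f) (hg : IsTimeBound g) : IsTimeBound (f ∘ g) := fun n =>
  ⟨(hg.le n).trans (hf.le _), hf.monotone (hg n).2⟩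

/-- The overhead of the layout phase is absorbed by a composition of time bounds. -/
theorem inBigO_comp (hf : IsTimeBound f) (hg : IsTimeBound g) {s t : ℕ → ℕ} (hs : InBigO s g)
    (ht : InBigO t f) : InBigO (fun n => 2 * s n + 2 * g n + 8 + t (g n)) (f ∘ g) := by
  have hgf : InBigO g (f ∘ g) := InBigO.of_le fun n => hf.le _
  exact ((((hs.trans hgf).const_mul 2).add (hgf.const_mul 2)).add
    (InBigO.const 8 (hf.comp hg).le)).add (ht.comp hg.tendsto_atTop)

end IsTimeBound

theorem timeConstructible_comp {f g : ℕ → ℕ} (hf : IsTimeBound f) (hg : IsTimeBound g)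
    (hfc : TimeConstructible f) (hgc : TimeConstructible g) : TimeConstructible (f ∘ g) := by
  obtain ⟨b₂, hb₂⟩ := hfc
  obtain ⟨b₁, hb₁⟩ := hgc
  refine ⟨Pipeline.numTapes b₁ b₂, fun α _ => ?_⟩
  obtain ⟨G, one, j, s, hone, hs, hG⟩ := hb₁ α
  obtain ⟨N, one', j', t, hone', ht, hN⟩ := hb₂ Unit
  let P : Pipeline α Unit b₁ b₂ :=
    { G := G, N := N, j := j, h := fun _ => .letter (), h_ne := by simp, K := 0, clocked := False }
  refine ⟨P.machine, ((G.blank, false), .rightEnd, one'),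
    Pipeline.tapeEquiv b₁ b₂ (.inr (.inl j')), fun n => 2 * s n + 2 * g n + 8 + t (g n), ?_,
    hf.inBigO_comp hg hs ht, fun w => ?_⟩
  · intro h
    exact hone' (congrArg (fun x : P.Symbol => x.2.2) h)
  have hx := hN (List.replicate (g w.length) ())
  rw [List.length_replicate] at hx
  obtain ⟨hhalt, k, ih, h₁, t₁, V, hrun⟩ := Pipeline.exists_run_of_halted (P := P) (hG w).1 hone
    (hG w).2 (fun p hp => by
      rw [List.length_replicate] at hp
      rcases p with _ | p
      · rfl
      · rw [inputSymbolAt_succ, List.getElem?_replicate]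
        simp only [Pipeline.virtualTape, P]
        split_ifs <;> first | rfl | omega) hx.1 (fun h => h.elim) le_rfl
  refine ⟨hhalt, fun p => ?_⟩
  rw [hrun]
  have hval : (P.simulateView (P.N.run (List.replicate (g w.length) ()) (t (g w.length)))
      k ih h₁ t₁ V).toCfg.tape (Pipeline.tapeEquiv b₁ b₂ (.inr (.inl j'))) p =
        ((G.blank, false), .rightEnd,
          (N.run (List.replicate (g w.length) ()) (t (g w.length))).tape j' p) := by
    simp only [Pipeline.View.toCfg, Function.comp_apply, Equiv.symm_apply_apply]
    rfl
  rw [hval, hx.2 p]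
  by_cases hp : p < f (g w.length)
  · rw [if_pos hp]
    exact (if_pos hp).symm
  · rw [if_neg hp]
    exact (if_neg hp).symm

/-- The word before the first padding symbol. -/
def unpad {α : Type} : List (Option α) → List α
  | some a :: x => a :: unpad x
  | _ => []

/-- The word `w`, padded to length `m`. -/
def padTo {α : Type} (m : ℕ) (w : List α) : List (Option α) :=
  w.map some ++ List.replicate (m - w.length) none

theorem length_padTo {α : Type} {m : ℕ} {w : List α} (h : w.length ≤ m) :
    (padTo m w).length = m := by
  simp [padTo]; omega

theorem unpad_padTo {α : Type} (m : ℕ) (w : List α) : unpad (padTo m w) = w := by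
  have h (k : ℕ) : unpad (w.map some ++ List.replicate k none) = w := by
    induction w with
    | nil => cases k <;> rfl
    | cons a w ih => simp [unpad, ih]
  exact h _

/-- The input symbol for the unpadded word. -/
def InputSymbol.unpad {α : Type} : InputSymbol (Option α) → InputSymbol α
  | .letter (some a) => .letter a
  | _ => .rightEnd

theorem unpad_inputSymbolAt {α : Type} (x : List (Option α)) {p : ℕ}
    (hp : p ≤ (unpad x).length) :
    (inputSymbolAt x (p + 1)).unpad = inputSymbolAt (unpad x) (p + 1) := by
  induction x generalizing p with
  | nil => simp [inputSymbolAt_succ, unpad, InputSymbol.unpad]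
  | cons a x ih =>
    cases a with
    | none =>
      simp only [unpad, List.length_nil, Nat.le_zero] at hp
      subst hp
      simp [inputSymbolAt_succ, unpad, InputSymbol.unpad]
    | some a =>
      cases p with
      | zero => simp [inputSymbolAt_succ, unpad, InputSymbol.unpad]
      | succ p =>
        have := ih (p := p) (by simpa [unpad] using hp)
        simpa [inputSymbolAt_succ, unpad] using this

/-- A machine on the unpadded word can be simulated with the clock provided by a time-constructible
time bound. -/
theorem mem_DT_of_clock {α : Type} [Finite α] {b : ℕ} (M : DTM α b) (K : ℕ) {f : ℕ → ℕ}
    (hf : IsTimeBound f) (hfc : TimeConstructible f) {L : Language (Option α)}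
    (hL : ∀ x, x ∈ L ↔ M.Halted (unpad x) (M.run (unpad x) (f x.length * (K + 1) + K)) ∧
      (M.run (unpad x) (f x.length * (K + 1) + K)).state ∈ M.accepting) :
    L ∈ DT (Option α) f := by
  obtain ⟨b₁, hb₁⟩ := hfc
  obtain ⟨G, one, j, s, hone, hs, hG⟩ := hb₁ (Option α)
  let P : Pipeline (Option α) α b₁ b :=
    { G := G, N := M, j := j, h := InputSymbol.unpad,
      h_ne := by rintro (_ | (_ | _) | _) <;> simp [InputSymbol.unpad]
      K := K, clocked := True }
  refine Set.mem_iUnion.2 ⟨_, P.machine,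
    fun n => 2 * s n + 2 * f n + 9 + (f n * (K + 1) + K), ?_, fun x => ?_⟩
  · have hff : InBigO f f := InBigO.of_le fun _ => le_rfl
    refine (((hs.const_mul 2).add (hff.const_mul 2)).add (InBigO.const 9 hf.le)).add
      (InBigO.add ?_ (InBigO.const K hf.le))
    simpa only [mul_comm] using hff.const_mul (K + 1)
  have hV : ∀ p ≤ (unpad x).length + 1,
      P.virtualTape x (f x.length) p = inputSymbolAt (unpad x) p := by
    intro p hp
    rcases p with _ | p
    · rfl
    rw [← unpad_inputSymbolAt x (by omega)]
    simp only [Pipeline.virtualTape, Nat.add_eq_zero_iff, one_ne_zero, and_false, if_false]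
    split_ifs with h
    · rfl
    · have := hf.le x.length
      rw [inputSymbolAt_eq_rightEnd_iff.2 (by omega)]
      rfl
  rw [hL]
  by_cases hS : M.Halted (unpad x) (M.run (unpad x) (f x.length * (K + 1) + K))
  · obtain ⟨hhalt, k, ih, h₁, t₁, V, hrun⟩ := Pipeline.exists_run_of_halted (P := P) (hG x).1 hone
      (hG x).2 hV hS (fun _ => le_rfl)
      (t := 2 * s x.length + 2 * f x.length + 9 + (f x.length * (K + 1) + K)) (by omega)
    refine ⟨hhalt, ?_⟩
    rw [hrun, Pipeline.state_toCfg_mem_accepting]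
    exact ⟨fun h => ⟨hS, h⟩, fun h => h.2⟩
  · obtain ⟨hhalt, hrej⟩ := Pipeline.exists_run_of_timeout (P := P) (hG x).1 hone (hG x).2 hV
      trivial hS le_rfl
    exact ⟨hhalt, fun h => absurd h hrej, fun h => absurd h.1 hS⟩

/-- Membership of the padded word in a language from `DT f` can be decided in time `f ∘ g`. -/
theorem mem_DT_comp_of_padTo {α : Type} [Finite α] {f g : ℕ → ℕ} (hf : IsTimeBound f)
    (hg : IsTimeBound g) (hgc : TimeConstructible g) {L' : Language (Option α)}
    (hL' : L' ∈ DT (Option α) f) {L : Language α}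
    (hL : ∀ w, w ∈ L ↔ padTo (g w.length) w ∈ L') : L ∈ DT α (f ∘ g) := by
  obtain ⟨b₁, hb₁⟩ := hgc
  obtain ⟨G, one, j, s, hone, hs, hG⟩ := hb₁ α
  obtain ⟨b₂, N, t, ht, hN⟩ := Set.mem_iUnion.1 hL'
  let P : Pipeline α (Option α) b₁ b₂ :=
    { G := G, N := N, j := j
      h := fun s => match s with
        | .letter a => .letter (some a)
        | _ => .letter none
      h_ne := by rintro (_ | _ | _) <;> simp
      K := 0, clocked := False }
  refine Set.mem_iUnion.2 ⟨_, P.machine, fun n => 2 * s n + 2 * g n + 8 + t (g n),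
    hf.inBigO_comp hg hs ht, fun w => ?_⟩
  have hx := hN (padTo (g w.length) w)
  rw [length_padTo (hg.le _)] at hx
  have hV : ∀ p ≤ (padTo (g w.length) w).length + 1,
      P.virtualTape w (g w.length) p = inputSymbolAt (padTo (g w.length) w) p := by
    intro p hp
    rcases p with _ | p
    · rfl
    have hle := hg.le w.length
    simp only [Pipeline.virtualTape, inputSymbolAt_succ, padTo, P, Nat.add_eq_zero_iff, one_ne_zero,
      and_false, if_false, List.getElem?_append, List.length_map, List.getElem?_map,
      List.getElem?_replicate]
    rcases lt_or_ge p w.length with h | h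
    · rw [if_pos (by omega), if_pos h, List.getElem?_eq_getElem h]
      rfl
    · rw [if_neg (show ¬ p < w.length by omega), List.getElem?_eq_none h]
      rcases lt_or_ge p (g w.length) with h' | h'
      · rw [if_pos (show p + 1 ≤ _ by omega),
          if_pos (show p - w.length < g w.length - w.length by omega)]
      · rw [if_neg (show ¬ p + 1 ≤ _ by omega),
          if_neg (show ¬ p - w.length < g w.length - w.length by omega)]
  obtain ⟨hhalt, k, ih, h₁, t₁, V, hrun⟩ := Pipeline.exists_run_of_halted (P := P) (hG w).1 hone
    (hG w).2 hV hx.1 (fun h => h.elim) le_rfl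
  refine ⟨hhalt, ?_⟩
  rw [hrun, Pipeline.state_toCfg_mem_accepting, hL]
  exact hx.2

theorem DT_mono {α : Type} {f f₂ : ℕ → ℕ} (h : InBigO f f₂) : DT α f ⊆ DT α f₂ :=
  Set.iUnion_mono fun _ _ ⟨M, t, ht, hM⟩ => ⟨M, t, ht.trans h, hM⟩

/-- Padding: an inclusion between time classes is inherited by larger time bounds. -/
theorem DT_comp_subset {f f₂ g : ℕ → ℕ} (hf : IsTimeBound f) (hf₂ : IsTimeBound f₂)
    (hf₂c : TimeConstructible f₂) (hg : IsTimeBound g) (hgc : TimeConstructible g) {α : Type}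
    [Finite α] (h : DT (Option α) f₂ ⊆ DT (Option α) f) : DT α (f₂ ∘ g) ⊆ DT α (f ∘ g) := by
  intro L hL
  obtain ⟨b, M, t, ht, hM⟩ := Set.mem_iUnion.1 hL
  obtain ⟨K, hK⟩ := ht.exists_forall_le
  let L' : Language (Option α) :=
    {x | M.Halted (unpad x) (M.run (unpad x) (f₂ x.length * (K + 1) + K)) ∧
      (M.run (unpad x) (f₂ x.length * (K + 1) + K)).state ∈ M.accepting}
  refine mem_DT_comp_of_padTo hf hg hgc
    (h (mem_DT_of_clock M K hf₂ hf₂c (L := L') fun x => Iff.rfl)) fun w => ?_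
  have hrun := DTM.run_eq_of_halted (hM w).1 (hK w.length)
  change w ∈ L ↔ M.Halted _ _ ∧ _ ∈ M.accepting
  rw [unpad_padTo, length_padTo (hg.le _)]
  simp only [Function.comp_apply] at hrun
  rw [hrun, (hM w).2]
  exact ⟨fun h => ⟨(hM w).1, h⟩, fun h => h.2⟩

theorem lemma5 (f g : ℕ → ℕ) (hf : IsTimeBound f) (hg : IsTimeBound g)
    (hgc : TimeConstructible g) (hG : GapProperty f) :
    GapProperty (f ∘ g) := by
  obtain ⟨f₂, hf₂, hf₂c, ho, hDT⟩ := hG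
  refine ⟨f₂ ∘ g, hf₂.comp hg, timeConstructible_comp hf₂ hg hf₂c hgc,
    IsLittleO.comp_tendsto ho hg.tendsto_atTop, fun α _ => Set.Subset.antisymm ?_ ?_⟩
  · exact DT_mono (InBigO.comp ho.isBigO hg.tendsto_atTop)
  · exact DT_comp_subset hf hf₂ hf₂c hg hgc (hDT (Option α)).ge
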